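/- For $N\ge 1$ and $\mathbf b=(b_0,\dots,b_{N-1})\in\mathbb C^N$ let $$\tilde p_{\mathbf b}(x)=(x^N+x^{-N})+b_0+\sum_{n=1}^{N-1}b_n\,(x^n+x^{-n})$$ be the monic reciprocal Laurent polynomial with coefficient vector $\mathbf b$, and let $$\nu_{\rm rec}(\mathbf b)=\exp\Big\{\int_0^1\log\big|\tilde p_{\mathbf b}(e^{2\pi i t})\big|\,dt\Big\}$$ be its Mahler measure. Let $\lambda_{2N}$ be Lebesgue measure on $\mathbb C^N$. Then for every positive integer $N$ the integral $$H_N(s)=\int_{\mathbb C^N}\nu_{\rm rec}(\mathbf b)^{-2s}\,d\lambda_{2N}(\mathbf b)$$ converges absolutely for every $s\in\mathbb C$ with $\Re s>N$. The function $H_N$ is analytic on the half plane $\Re s>N$, and it extends by analytic continuation to $\mathbb C\setminus\{\pm1,\dots,\pm N\}$, where it is equal to the rational function $$\prod_{n=1}^N\frac{2\pi s}{s^2-n^2}.$$ This rational function is an even function of $s$ if $N$ is even, and an odd function of $s$ if $N$ is odd. -/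

import Mathlib

open MeasureTheory

noncomputable section

/-- The value `p(x)` of a complex Laurent polynomial `p` at a nonzero complex number `x`. -/
def laurentEval (p : LaurentPolynomial ℂ) (x : ℂˣ) : ℂ :=
  LaurentPolynomial.eval₂ (RingHom.id ℂ) x p

/-- The point `e ^ (2 π i t)` of the unit circle, as a unit of `ℂ`. -/
def unitCirclePoint (t : ℝ) : ℂˣ :=
  Units.mk0 (Complex.exp (2 * Real.pi * Complex.I * t)) (Complex.exp_ne_zero _)

open Classical in
/-- The Mahler measure `μ(p) = exp (∫₀¹ log |p(e ^ (2 π i t))| dt)` of a complex Laurent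
polynomial, with `μ(0) = exp (-∞) = 0`. -/
def laurentMahlerMeasure (p : LaurentPolynomial ℂ) : ℝ :=
  if p = 0 then 0
  else Real.exp (∫ t in (0 : ℝ)..1, Real.log ‖laurentEval p (unitCirclePoint t)‖)

/-- The reciprocal Laurent polynomial `v₀ + ∑_{n=1}^N vₙ (xⁿ + x⁻ⁿ)` with coefficient vector
`v = (v₀, …, v_N)`. -/
def reciprocalLaurent {N : ℕ} (v : Fin (N + 1) → ℂ) : LaurentPolynomial ℂ :=
  LaurentPolynomial.C (v 0) +
    ∑ n : Fin N, LaurentPolynomial.C (v n.succ) *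
      (LaurentPolynomial.T ((n : ℤ) + 1) + LaurentPolynomial.T (-((n : ℤ) + 1)))

/-- The reciprocal Mahler measure `μ_rec : ℂ^(N+1) → ℝ`. -/
def recMahler {N : ℕ} (v : Fin (N + 1) → ℂ) : ℝ :=
  laurentMahlerMeasure (reciprocalLaurent v)

/-- The monic reciprocal Mahler measure `ν_rec : ℂ^N → ℝ`: the coefficient vector is
`(b₀, …, b_{N-1}, 1)`. -/
def monicRecMahler {N : ℕ} (b : Fin N → ℂ) : ℝ :=
  recMahler (Fin.snoc b 1 : Fin (N + 1) → ℂ)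

/-- The integral `H_N(s) = ∫_{ℂ^N} ν_rec(b)^(-2s) dλ_{2N}(b)`, with respect to Lebesgue measure. -/
def recMahlerIntegral (N : ℕ) (s : ℂ) : ℂ :=
  ∫ b : Fin N → ℂ, ((monicRecMahler b : ℝ) : ℂ) ^ (-2 * s)

/-- `g`, analytic on the connected open set `V`, is the analytic continuation to `V` of the function
`f`, analytic on the nonempty open set `U ⊆ V`. -/
structure IsAnalyticContinuation (f : ℂ → ℂ) (U : Set ℂ) (g : ℂ → ℂ) (V : Set ℂ) : Prop where
  isOpen_left : IsOpen U
  nonempty_left : U.Nonempty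
  isOpen_right : IsOpen V
  isConnected_right : IsConnected V
  subset : U ⊆ V
  analytic_left : AnalyticOnNhd ℂ f U
  analytic_right : AnalyticOnNhd ℂ g V
  eqOn : Set.EqOn f g U

end

/-!
Write the monic reciprocal Laurent polynomial as `p̃_b x = P_b (x + x⁻¹)`, where `P_b` is the
combination, with coefficients `b`, of the monic Chebyshev polynomials `1, C₁, …, C_N` (`recPoly`).
Take the roots `β` of `P_b = ∏ (X - β i)` as new variables. The map `coeffOfRoots` from `β` to `b`
has real Jacobian `‖V(β)‖²`, with `V` the Vandermonde determinant (`abs_det_fderiv_coeffOfRoots`): the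
derivative of `P_b z = ∏ (z - β i)` in `β`, read at the points `z = β j`, is a diagonal matrix. On
the root vectors with increasing real parts the map is injective, with image of full measure. The
Mahler measure is the product of the Mahler measures of the factors `x + x⁻¹ - β i`
(`monicRecMahler_coeffOfRoots`). By symmetry the integral therefore equals `1 / N!` times the integral
of `‖V(β)‖² ∏ (linMahler (β i)) ^ (-2 s)` over all `β`.

In `V` the powers may be replaced by the monic Chebyshev polynomials `S_j` of the second kind.
Expanding `V` and its conjugate over permutations and using Fubini's theorem leaves the integrals
`∫ (linMahler β) ^ (-2 s) S_j(β) (S_k(β))⋆` over `ℂ` (`integral_chebGram`). The substitution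
`β = 2 cosh w`, `w = u + i θ`, from the half strip `u > 0`, `-π < θ ≤ π`, turns `linMahler β` into
`exp u` and `2 sinh w · S_j(β)` into `2 sinh ((j + 1) w)`. The integrand becomes a sum of exponentials
that are integrable when `Re s > N`, so the integral is `0` for `j ≠ k`, and for `j = k` it is
`2 π s / (s² - (j + 1)²)`. Only the `N!` diagonal terms survive, and each is the product in the theorem.

`RatFunc.eval` gives the value `0` at a pole. The rational function agrees everywhere with the
pointwise product of quotients, where division by zero is `0` too (`ratFunc_prod_eval`), and the
parity is read off from that product.
-/

open Polynomial

/-! ### Chebyshev polynomials -/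

/-- `X * p - q` is monic of degree `n + 2`, the inductive step of the Chebyshev recursions. -/
lemma monic_natDegree_X_mul_sub {p q : ℂ[X]} {n : ℕ} (hp : p.Monic) (hpn : p.natDegree = n + 1)
    (hq : q.natDegree ≤ n) : (X * p - q).Monic ∧ (X * p - q).natDegree = n + 2 := by
  have hX : (X * p).natDegree = n + 2 := by
    rw [natDegree_X_mul hp.ne_zero, hpn]
  have hm : (X * p).Monic := monic_X.mul hp
  have hlt : q.natDegree < (X * p).natDegree := by omega
  exact ⟨hm.sub_of_left (degree_lt_degree hlt),
    by rw [natDegree_sub_eq_left_of_natDegree_lt hlt, hX]⟩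

lemma chebyshevC_monic_natDegree (n : ℕ) :
    (Chebyshev.C ℂ ((n : ℤ) + 1)).Monic ∧ (Chebyshev.C ℂ ((n : ℤ) + 1)).natDegree = n + 1 := by
  induction n using Nat.twoStepInduction with
  | zero => simp [monic_X]
  | one =>
    have h := monic_natDegree_X_mul_sub (p := X) (q := 2) (n := 0) monic_X (by simp)
      (by simp)
    have e : Chebyshev.C ℂ (((1 : ℕ) : ℤ) + 1) = X * X - 2 := by
      norm_num [Chebyshev.C_two, sq]
    rw [e]
    exact h
  | more n h1 h2 =>
    have e : Chebyshev.C ℂ (((n + 2 : ℕ) : ℤ) + 1) =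
        X * Chebyshev.C ℂ (((n + 1 : ℕ) : ℤ) + 1) - Chebyshev.C ℂ ((n : ℤ) + 1) := by
      have := Chebyshev.C_add_two ℂ ((n : ℤ) + 1)
      push_cast
      rw [show (n : ℤ) + 2 + 1 = n + 1 + 2 by ring, this]
    rw [e]
    exact monic_natDegree_X_mul_sub h2.1 h2.2 h1.2.le

lemma chebyshevS_monic_natDegree (n : ℕ) :
    (Chebyshev.S ℂ (n : ℤ)).Monic ∧ (Chebyshev.S ℂ (n : ℤ)).natDegree = n := by
  induction n using Nat.twoStepInduction with
  | zero => simp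
  | one => simp [monic_X]
  | more n h1 h2 =>
    have e : Chebyshev.S ℂ ((n + 2 : ℕ) : ℤ) =
        X * Chebyshev.S ℂ ((n + 1 : ℕ) : ℤ) - Chebyshev.S ℂ (n : ℤ) := by
      push_cast
      exact Chebyshev.S_add_two ℂ n
    rw [e]
    exact monic_natDegree_X_mul_sub h2.1 h2.2 h1.2.le

/-- The monic polynomials `1, C₁, C₂, …`, where `Cₙ` is the rescaled Chebyshev polynomial of the
first kind, with `Cₙ (x + x⁻¹) = xⁿ + x⁻ⁿ`. The constant `C₀ = 2` is replaced by `1`, as the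
reciprocal Laurent polynomials have constant term `b₀` rather than `2 b₀`. -/
noncomputable def chebBasis (n : ℕ) : ℂ[X] := if n = 0 then 1 else Chebyshev.C ℂ n

@[simp] lemma chebBasis_zero : chebBasis 0 = 1 := by simp [chebBasis]

lemma chebBasis_monic (n : ℕ) : (chebBasis n).Monic := by
  cases n with
  | zero => simp
  | succ n => simpa [chebBasis] using (chebyshevC_monic_natDegree n).1

lemma chebBasis_natDegree (n : ℕ) : (chebBasis n).natDegree = n := by
  cases n with
  | zero => simp
  | succ n => simpa [chebBasis] using (chebyshevC_monic_natDegree n).2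

lemma chebyshevC_eval_add_inv (n : ℕ) {x : ℂ} (hx : x ≠ 0) :
    (Chebyshev.C ℂ n).eval (x + x⁻¹) = x ^ n + (x⁻¹) ^ n := by
  induction n using Nat.twoStepInduction with
  | zero => norm_num
  | one => simp
  | more n h1 h2 =>
    have := Chebyshev.C_add_two ℂ n
    push_cast at h2 ⊢
    rw [this, eval_sub, eval_mul, eval_X, h1, h2]
    linear_combination (x ^ n + x⁻¹ ^ n) * mul_inv_cancel₀ hx

lemma chebBasis_succ_eval_add_inv (n : ℕ) {x : ℂ} (hx : x ≠ 0) :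
    (chebBasis (n + 1)).eval (x + x⁻¹) = x ^ (n + 1) + (x⁻¹) ^ (n + 1) := by
  simpa [chebBasis] using chebyshevC_eval_add_inv (n + 1) hx

/-! ### Reciprocal polynomials and their roots -/

/-- The polynomial `P_b` with `P_b (x + x⁻¹) = p̃_b x`, where `p̃_b` is the monic reciprocal Laurent
polynomial with coefficient vector `b`. -/
noncomputable def recPoly {N : ℕ} (b : Fin N → ℂ) : ℂ[X] :=
  chebBasis N + ∑ n : Fin N, C (b n) * chebBasis n

lemma recPoly_sum_degree_lt {N : ℕ} (b : Fin N → ℂ) :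
    (∑ n : Fin N, C (b n) * chebBasis n).degree < (N : WithBot ℕ) := by
  rw [← mem_degreeLT]
  refine Submodule.sum_mem _ fun n _ => ?_
  rw [← smul_eq_C_mul]
  refine Submodule.smul_mem _ _ ?_
  rw [mem_degreeLT, degree_eq_natDegree (chebBasis_monic _).ne_zero, chebBasis_natDegree]
  exact_mod_cast n.2

lemma chebBasis_degree (n : ℕ) : (chebBasis n).degree = n := by
  rw [degree_eq_natDegree (chebBasis_monic _).ne_zero, chebBasis_natDegree]

lemma recPoly_monic {N : ℕ} (b : Fin N → ℂ) : (recPoly b).Monic :=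
  (chebBasis_monic N).add_of_left (by rw [chebBasis_degree]; exact recPoly_sum_degree_lt b)

lemma recPoly_degree {N : ℕ} (b : Fin N → ℂ) : (recPoly b).degree = N := by
  rw [recPoly, degree_add_eq_left_of_degree_lt, chebBasis_degree]
  rw [chebBasis_degree]; exact recPoly_sum_degree_lt b

lemma recPoly_natDegree {N : ℕ} (b : Fin N → ℂ) : (recPoly b).natDegree = N :=
  natDegree_eq_of_degree_eq_some (recPoly_degree b)

lemma recPoly_eval {N : ℕ} (b : Fin N → ℂ) (z : ℂ) :
    (recPoly b).eval z = (chebBasis N).eval z + ∑ n : Fin N, (chebBasis n).eval z * b n := by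
  simp [recPoly, eval_finsetSum, mul_comm]

/-- The matrix `(C_j (z_i))` of the polynomials `chebBasis` at `N` points. -/
noncomputable def chebMatrix {N : ℕ} (z : Fin N → ℂ) : Matrix (Fin N) (Fin N) ℂ :=
  Matrix.of fun i j => (chebBasis j).eval (z i)

lemma det_chebMatrix {N : ℕ} (z : Fin N → ℂ) :
    (chebMatrix z).det = (Matrix.vandermonde z).det :=
  (Matrix.det_eval_matrixOfPolynomials_eq_det_vandermonde z (fun j => chebBasis j)
    (fun _ => chebBasis_natDegree _) (fun _ => chebBasis_monic _)).symm

/-- The interpolation nodes `0, 1, …, N - 1`. -/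
def nodes (N : ℕ) (k : Fin N) : ℂ := (k : ℕ)

lemma nodes_injective (N : ℕ) : Function.Injective (nodes N) := fun i j h => by
  simpa [nodes, Fin.ext_iff] using h

lemma isUnit_det_chebMatrix_nodes (N : ℕ) : IsUnit (chebMatrix (nodes N)).det := by
  rw [det_chebMatrix, isUnit_iff_ne_zero, Matrix.det_vandermonde_ne_zero_iff]
  exact nodes_injective N

/-- The coefficient vector `b` of the polynomial `P_b` with roots `β`. It is written as the solution
of the linear system that expresses `P_b = ∏ (X - β i)` at the interpolation nodes, so that it is
visibly a differentiable function of `β`. -/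
noncomputable def coeffOfRoots {N : ℕ} (β : Fin N → ℂ) : Fin N → ℂ :=
  (chebMatrix (nodes N))⁻¹.mulVec
    fun k => ∏ i, (nodes N k - β i) - (chebBasis N).eval (nodes N k)

lemma recPoly_coeffOfRoots {N : ℕ} (β : Fin N → ℂ) :
    recPoly (coeffOfRoots β) = ∏ i, (X - C (β i)) := by
  classical
  have hm : (∏ i, (X - C (β i))).Monic := monic_prod_of_monic _ _ fun i _ => monic_X_sub_C _
  have hd : (∏ i, (X - C (β i))).degree = (N : WithBot ℕ) := by simp [degree_prod]
  refine eq_of_degree_sub_lt_of_eval_finset_eq (Finset.univ.image (nodes N)) ?_ ?_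
  · rw [Finset.card_image_of_injective _ (nodes_injective N), Finset.card_univ, Fintype.card_fin]
    rw [← recPoly_degree (coeffOfRoots β)]
    exact degree_sub_lt_left (by rw [recPoly_degree, hd]) (recPoly_monic _).ne_zero
      (by rw [(recPoly_monic _).leadingCoeff, hm.leadingCoeff])
  · intro x hx
    obtain ⟨k, -, rfl⟩ := Finset.mem_image.mp hx
    have h : (chebMatrix (nodes N)).mulVec (coeffOfRoots β) =
        fun k => ∏ i, (nodes N k - β i) - (chebBasis N).eval (nodes N k) := by
      rw [coeffOfRoots, Matrix.mulVec_mulVec, Matrix.mul_nonsing_inv _ (isUnit_det_chebMatrix_nodes N),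
        Matrix.one_mulVec]
    have hk := congrFun h k
    rw [recPoly_eval]
    simp only [Matrix.mulVec, dotProduct, chebMatrix, Matrix.of_apply] at hk
    rw [hk, eval_prod]
    simp

lemma recPoly_injective {N : ℕ} : Function.Injective (recPoly : (Fin N → ℂ) → ℂ[X]) := by
  intro b c h
  have hu : Function.Injective (chebMatrix (nodes N)).mulVec :=
    Matrix.mulVec_injective_of_isUnit
      ((Matrix.isUnit_iff_isUnit_det _).mpr (isUnit_det_chebMatrix_nodes N))
  apply hu
  funext k
  have hk := congrArg (eval (nodes N k)) h
  rw [recPoly_eval, recPoly_eval] at hk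
  exact add_left_cancel hk

lemma coeffOfRoots_surjective {N : ℕ} (b : Fin N → ℂ) : ∃ β, coeffOfRoots β = b := by
  have hs : (recPoly b).Splits := IsAlgClosed.splits _
  have hc : (recPoly b).roots.card = N := by
    rw [← hs.natDegree_eq_card_roots, recPoly_natDegree]
  obtain ⟨l, hl⟩ := Quot.exists_rep (recPoly b).roots
  have hl' : (l : Multiset ℂ) = (recPoly b).roots := hl
  have hlen : l.length = N := by rw [← hc, ← hl']; simp
  subst hlen
  refine ⟨l.get, recPoly_injective ?_⟩
  rw [recPoly_coeffOfRoots]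
  have := hs.eq_prod_roots_of_monic (recPoly_monic b)
  rw [this, ← hl']
  simp only [Multiset.map_coe, Multiset.prod_coe]
  rw [← List.prod_ofFn]
  congr 1
  exact (List.ofFn_getElem_eq_map l (fun a => X - C a))

/-! ### The Jacobian of the map from roots to coefficients -/

lemma differentiable_coeffOfRoots (N : ℕ) :
    Differentiable ℂ (coeffOfRoots : (Fin N → ℂ) → (Fin N → ℂ)) := by
  unfold coeffOfRoots
  rw [differentiable_pi]
  intro n
  simp only [Matrix.mulVec, dotProduct]
  fun_prop

/-- The matrix of the derivative of `coeffOfRoots`, multiplied by `chebMatrix β`, is diagonal: this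
is the derivative of `P_b z = ∏ (z - β i)` in `β`, taken at the points `z = β j`. -/
lemma chebMatrix_mul_toMatrix_fderiv {N : ℕ} (β : Fin N → ℂ) :
    chebMatrix β * LinearMap.toMatrix' (fderiv ℂ coeffOfRoots β : (Fin N → ℂ) →ₗ[ℂ] (Fin N → ℂ)) =
      Matrix.diagonal fun i => -∏ l ∈ {i}ᶜ, (β i - β l) := by
  classical
  ext j i
  have hB := ((differentiable_coeffOfRoots N) β).hasFDerivAt
  rw [hasFDerivAt_pi'] at hB
  have h1 : HasFDerivAt (fun γ : Fin N → ℂ => ∑ n : Fin N, (chebBasis n).eval (β j) * coeffOfRoots γ n)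
      (∑ n : Fin N, (chebBasis n).eval (β j) •
        ((ContinuousLinearMap.proj n).comp (fderiv ℂ coeffOfRoots β))) β :=
    HasFDerivAt.fun_sum fun n _ => (hB n).const_mul _
  have h2 : HasFDerivAt (fun γ : Fin N → ℂ => ∏ k, (β j - γ k) - (chebBasis N).eval (β j))
      (∑ k, (∏ l ∈ Finset.univ.erase k, (β j - β l)) •
        (-(ContinuousLinearMap.proj k : (Fin N → ℂ) →L[ℂ] ℂ))) β :=
    (HasFDerivAt.finsetProd (fun k _ => (hasFDerivAt_apply k β).const_sub _)).sub_const _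
  have he : (fun γ : Fin N → ℂ => ∑ n : Fin N, (chebBasis n).eval (β j) * coeffOfRoots γ n) =
      fun γ : Fin N → ℂ => ∏ k, (β j - γ k) - (chebBasis N).eval (β j) := by
    funext γ
    have := congrArg (eval (β j)) (recPoly_coeffOfRoots γ)
    rw [recPoly_eval, eval_prod] at this
    simp only [eval_sub, eval_X, eval_C] at this
    rw [← this]; ring
  rw [he] at h1
  -- Two derivatives of the same function; the `i`-th partial derivative is the entry `(j, i)`.
  have h3 := DFunLike.congr_fun (h1.unique h2) (Pi.single i 1)
  rw [Matrix.mul_apply]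
  simp only [sum_apply, smul_apply, ContinuousLinearMap.comp_apply, ContinuousLinearMap.proj_apply,
    neg_apply, smul_eq_mul] at h3
  simp only [chebMatrix, Matrix.of_apply, LinearMap.toMatrix'_apply, ContinuousLinearMap.coe_coe]
  rw [h3, Finset.sum_eq_single i]
  · rw [Matrix.diagonal_apply]
    split_ifs with hji
    · subst hji
      simp [Finset.compl_singleton]
    · rw [Finset.prod_eq_zero (i := j) (by simp [hji]) (by simp)]
      simp
  · intro k _ hk
    simp [hk]
  · simp

/-- The complex Jacobian of the map from roots to coefficients is a Vandermonde determinant, up to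
sign. -/
lemma norm_det_fderiv_coeffOfRoots {N : ℕ} {β : Fin N → ℂ} (hβ : Function.Injective β) :
    ‖LinearMap.det (fderiv ℂ coeffOfRoots β : (Fin N → ℂ) →ₗ[ℂ] (Fin N → ℂ))‖ =
      ‖(Matrix.vandermonde β).det‖ := by
  classical
  have h := congrArg (fun M => ‖Matrix.det M‖) (chebMatrix_mul_toMatrix_fderiv β)
  simp only [Matrix.det_mul, norm_mul, det_chebMatrix, Matrix.det_diagonal, LinearMap.det_toMatrix',
    norm_prod, norm_neg] at h
  have h0 : ‖(Matrix.vandermonde β).det‖ ≠ 0 := by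
    rw [norm_ne_zero_iff]; exact Matrix.det_vandermonde_ne_zero_iff.mpr hβ
  refine mul_left_cancel₀ h0 (h.trans ?_)
  simp only [Matrix.det_vandermonde, norm_prod]
  rw [← Finset.prod_mul_distrib]
  simp only [← Finset.prod_mul_distrib]
  rw [← Finset.prod_congr rfl fun i _ => Finset.prod_congr rfl fun l _ => norm_sub_rev (β l) (β i)]
  rw [← Finset.prod_prod_Ioi_mul_eq_prod_prod_off_diag (fun j i => ‖β j - β i‖)]
  refine Finset.prod_congr rfl fun i _ => Finset.prod_congr rfl fun l _ => ?_
  rw [norm_sub_rev (β i) (β l)]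

/-- The real Jacobian of the map from roots to coefficients. -/
lemma abs_det_fderiv_coeffOfRoots {N : ℕ} {β : Fin N → ℂ} (hβ : Function.Injective β) :
    |((fderiv ℂ coeffOfRoots β).restrictScalars ℝ).det| = ‖(Matrix.vandermonde β).det‖ ^ 2 := by
  rw [← norm_det_fderiv_coeffOfRoots hβ]
  have : ((fderiv ℂ coeffOfRoots β).restrictScalars ℝ).det =
      Algebra.norm ℝ (LinearMap.det (fderiv ℂ coeffOfRoots β : (Fin N → ℂ) →ₗ[ℂ] (Fin N → ℂ))) := by
    rw [← LinearMap.det_restrictScalars]; rfl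
  rw [this, Algebra.norm_complex_eq]
  simp [Complex.normSq_eq_norm_sq]

/-! ### The Mahler measure of one factor, and the substitution `β = 2 cosh w` -/

/-- The Mahler measure of `x + x⁻¹ - β`, computed as that of the polynomial `x² - β x + 1`. -/
noncomputable def linMahler (β : ℂ) : ℝ := (X ^ 2 - C β * X + 1 : ℂ[X]).mahlerMeasure

lemma linMahler_poly_monic (β : ℂ) : (X ^ 2 - C β * X + 1 : ℂ[X]).Monic := by
  monicity!

lemma linMahler_pos (β : ℂ) : 0 < linMahler β :=
  mahlerMeasure_pos_of_ne_zero (linMahler_poly_monic β).ne_zero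

/-- `x² - β x + 1` has the roots `exp (± w)` if `β = 2 cosh w`. -/
lemma linMahler_two_mul_cosh {w : ℂ} (hw : 0 ≤ w.re) :
    linMahler (2 * Complex.cosh w) = Real.exp w.re := by
  have h : (X ^ 2 - C (2 * Complex.cosh w) * X + 1 : ℂ[X]) =
      (X - C (Complex.exp w)) * (X - C (Complex.exp (-w))) := by
    have h2 : (1 : ℂ[X]) = C (Complex.exp w) * C (Complex.exp (-w)) := by
      rw [← C_mul, ← Complex.exp_add]; simp
    have h3 : 2 * Complex.cosh w = Complex.exp w + Complex.exp (-w) := by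
      rw [Complex.cosh]; ring
    rw [h3, C_add, h2]; ring
  rw [linMahler, h, mahlerMeasure_mul, mahlerMeasure_X_sub_C, mahlerMeasure_X_sub_C,
    Complex.norm_exp, Complex.norm_exp, Complex.neg_re, max_eq_right (Real.one_le_exp hw),
    max_eq_left (Real.exp_le_one_iff.mpr (by linarith)), mul_one]

/-- The half strip that `w ↦ 2 cosh w` maps bijectively onto `ℂ ∖ [-2, 2]`. -/
def halfStrip : Set ℂ := {w | 0 < w.re ∧ w.im ∈ Set.Ioc (-Real.pi) Real.pi}

lemma halfStrip_eq_preimage : halfStrip =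
    Complex.measurableEquivRealProd ⁻¹' (Set.Ioi 0 ×ˢ Set.Ioc (-Real.pi) Real.pi) := by
  ext w; simp [halfStrip]

lemma measurableSet_halfStrip : MeasurableSet halfStrip := by
  rw [halfStrip_eq_preimage]
  exact Complex.measurableEquivRealProd.measurable (measurableSet_Ioi.prod measurableSet_Ioc)

lemma two_mul_cosh_injOn : Set.InjOn (fun w : ℂ => 2 * Complex.cosh w) halfStrip := by
  intro w hw v hv h
  have h' : Complex.exp w + Complex.exp (-w) = Complex.exp v + Complex.exp (-v) := by
    simpa [Complex.cosh, mul_div_cancel₀] using h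
  have hprod : Complex.exp w * Complex.exp v ≠ 1 := by
    intro h1
    have := congrArg norm h1
    rw [← Complex.exp_add, Complex.norm_exp, norm_one, Real.exp_eq_one_iff, Complex.add_re] at this
    linarith [hw.1, hv.1]
  rw [Complex.exp_neg, Complex.exp_neg] at h'
  have hw0 := Complex.exp_ne_zero w
  have hv0 := Complex.exp_ne_zero v
  field_simp at h'
  have h2 : (Complex.exp w - Complex.exp v) * (Complex.exp w * Complex.exp v - 1) = 0 := by
    linear_combination h'
  have h3 : Complex.exp w = Complex.exp v :=
    sub_eq_zero.mp ((mul_eq_zero.mp h2).resolve_right (sub_ne_zero.mpr hprod))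
  rw [← Complex.log_exp hw.2.1 hw.2.2, h3, Complex.log_exp hv.2.1 hv.2.2]

lemma exists_add_inv_eq (β : ℂ) : ∃ x : ℂ, x ≠ 0 ∧ x + x⁻¹ = β := by
  have hd : (X ^ 2 - C β * X + 1 : ℂ[X]).degree ≠ 0 := by
    have : (X ^ 2 - C β * X + 1 : ℂ[X]).degree = 2 := by compute_degree!
    rw [this]; norm_num
  obtain ⟨x, hx⟩ := IsAlgClosed.exists_root _ hd
  have hx' : x ^ 2 - β * x + 1 = 0 := by simpa [IsRoot] using hx
  have h0 : x ≠ 0 := by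
    rintro rfl; simp at hx'
  refine ⟨x, h0, ?_⟩
  field_simp
  linear_combination hx'

/-- If `β = x + x⁻¹` is not real then `‖x‖ ≠ 1`, and the logarithm of `x` or of `x⁻¹` lies in the
strip. -/
lemma mem_image_two_mul_cosh {β : ℂ} (hβ : β.im ≠ 0) :
    β ∈ (fun w : ℂ => 2 * Complex.cosh w) '' halfStrip := by
  have key : ∀ x : ℂ, 1 < ‖x‖ → x + x⁻¹ = β → β ∈ (fun w : ℂ => 2 * Complex.cosh w) '' halfStrip := by
    intro x hx hxβ
    have h0 : x ≠ 0 := by rintro rfl; simp at hx; linarith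
    refine ⟨Complex.log x, ⟨?_, ?_⟩, ?_⟩
    · rw [Complex.log_re]; exact Real.log_pos hx
    · rw [Complex.log_im]; exact Complex.arg_mem_Ioc x
    · simp only [Complex.cosh, Complex.exp_neg, Complex.exp_log h0, hxβ]; ring
  obtain ⟨x, h0, hx⟩ := exists_add_inv_eq β
  rcases lt_trichotomy ‖x‖ 1 with h | h | h
  · refine key x⁻¹ ?_ (by rw [inv_inv, add_comm, hx])
    rw [norm_inv]
    exact (one_lt_inv₀ (norm_pos_iff.mpr h0)).mpr h
  · refine absurd ?_ hβ
    rw [← hx, Complex.inv_eq_conj h]; simp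
  · exact key x h hx

lemma volume_compl_image_two_mul_cosh :
    volume ((fun w : ℂ => 2 * Complex.cosh w) '' halfStrip)ᶜ = 0 := by
  refine measure_mono_null (t := (LinearMap.ker Complex.imLm : Set ℂ)) ?_ ?_
  · intro β hβ
    by_contra h
    exact hβ (mem_image_two_mul_cosh (by simpa using h))
  · refine Measure.addHaar_submodule _ _ ?_
    intro h
    have : Complex.I ∈ LinearMap.ker Complex.imLm := by rw [h]; trivial
    simp at this

lemma integrable_iff_integrableOn_of_compl_null {E : Type*} [MeasurableSpace E] {μ : Measure E}
    {s : Set E} (f : E → ℂ) (hs : μ sᶜ = 0) : Integrable f μ ↔ IntegrableOn f s μ := by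
  rw [IntegrableOn, Measure.restrict_eq_self_of_ae_mem (show ∀ᵐ x ∂μ, x ∈ s from hs)]

lemma integral_eq_setIntegral_of_compl_null {E : Type*} [MeasurableSpace E] {μ : Measure E}
    {s : Set E} (f : E → ℂ) (hs : μ sᶜ = 0) : ∫ x, f x ∂μ = ∫ x in s, f x ∂μ := by
  rw [Measure.restrict_eq_self_of_ae_mem (show ∀ᵐ x ∂μ, x ∈ s from hs)]

lemma hasFDerivAt_two_mul_cosh (w : ℂ) : HasFDerivAt (fun w : ℂ => 2 * Complex.cosh w)
    ((ContinuousLinearMap.toSpanSingleton ℂ (2 * Complex.sinh w)).restrictScalars ℝ) w :=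
  ((Complex.hasDerivAt_cosh w).const_mul 2).hasFDerivAt.restrictScalars ℝ

lemma abs_det_toSpanSingleton_restrictScalars (a : ℂ) :
    |((ContinuousLinearMap.toSpanSingleton ℂ a).restrictScalars ℝ).det| = ‖a‖ ^ 2 := by
  have : ((ContinuousLinearMap.toSpanSingleton ℂ a).restrictScalars ℝ).det =
      Algebra.norm ℝ (LinearMap.det (ContinuousLinearMap.toSpanSingleton ℂ a : ℂ →ₗ[ℂ] ℂ)) := by
    rw [← LinearMap.det_restrictScalars]; rfl
  rw [this, Algebra.norm_complex_eq]
  simp [Complex.normSq_eq_norm_sq]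

/-! ### Orthogonality of the Chebyshev polynomials of the second kind -/

/-- The exponential `exp (a u + i k θ)` of `w = u + i θ`. -/
noncomputable def stripExp (a : ℂ) (k : ℤ) (w : ℂ) : ℂ :=
  Complex.exp (a * w.re) * Complex.exp (k * Complex.I * w.im)

lemma stripExp_integrableOn {a : ℂ} (ha : a.re < 0) (k : ℤ) :
    IntegrableOn (stripExp a k) halfStrip := by
  have h : IntegrableOn (fun p : ℝ × ℝ => Complex.exp (a * p.1) * Complex.exp (k * Complex.I * p.2))
      (Set.Ioi 0 ×ˢ Set.Ioc (-Real.pi) Real.pi) := by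
    rw [IntegrableOn, Measure.volume_eq_prod, ← Measure.prod_restrict]
    refine Integrable.mul_prod (f := fun u : ℝ => Complex.exp (a * u))
      (g := fun θ : ℝ => Complex.exp (k * Complex.I * θ)) (integrableOn_exp_mul_complex_Ioi ha 0) ?_
    exact (Continuous.integrableOn_Ioc (by fun_prop))
  rw [halfStrip_eq_preimage]
  exact (Complex.volume_preserving_equiv_real_prod.integrableOn_comp_preimage
    Complex.measurableEquivRealProd.measurableEmbedding).mpr h

lemma integral_exp_int_mul (k : ℤ) :
    ∫ θ in Set.Ioc (-Real.pi) Real.pi, Complex.exp (k * Complex.I * (θ : ℂ)) =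
      if k = 0 then 2 * (Real.pi : ℂ) else 0 := by
  rw [← intervalIntegral.integral_of_le (by linarith [Real.pi_pos])]
  split_ifs with hk
  · subst hk
    simp; ring
  · have hk' : (k : ℂ) * Complex.I ≠ 0 := mul_ne_zero (by exact_mod_cast hk) Complex.I_ne_zero
    rw [integral_exp_mul_complex hk']
    have : Complex.exp (k * Complex.I * (Real.pi : ℂ)) =
        Complex.exp (k * Complex.I * ((-Real.pi : ℝ) : ℂ)) := by
      rw [Complex.exp_eq_exp_iff_exists_int]
      exact ⟨k, by push_cast; ring⟩
    rw [this, sub_self, zero_div]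

lemma integral_stripExp {a : ℂ} (ha : a.re < 0) (k : ℤ) :
    ∫ w in halfStrip, stripExp a k w = if k = 0 then -(2 * (Real.pi : ℂ)) / a else 0 := by
  have h := Complex.volume_preserving_equiv_real_prod.setIntegral_preimage_emb
    Complex.measurableEquivRealProd.measurableEmbedding
    (fun p : ℝ × ℝ => Complex.exp (a * p.1) * Complex.exp (k * Complex.I * p.2))
    (Set.Ioi 0 ×ˢ Set.Ioc (-Real.pi) Real.pi)
  rw [← halfStrip_eq_preimage] at h
  refine h.trans ?_
  rw [Measure.volume_eq_prod, setIntegral_prod_mul (fun u : ℝ => Complex.exp (a * u))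
    (fun θ : ℝ => Complex.exp (k * Complex.I * θ)), integral_exp_int_mul,
    integral_exp_mul_complex_Ioi ha]
  split_ifs
  · simp; ring
  · simp

/-- The integrand of the Gram matrix of the Chebyshev polynomials of the second kind for the weight
`linMahler ^ (-2 s)`. -/
noncomputable def chebGram (s : ℂ) (j k : ℕ) (β : ℂ) : ℂ :=
  (linMahler β : ℂ) ^ (-2 * s) * ((Chebyshev.S ℂ j).eval β * star ((Chebyshev.S ℂ k).eval β))

/-- After the substitution `β = 2 cosh w` the integrand `chebGram` is a combination of exponentials,
since `S_j (2 cosh w) sinh w = sinh ((j + 1) w)`. -/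
lemma chebGram_two_mul_cosh (s : ℂ) (j k : ℕ) {w : ℂ} (hw : 0 ≤ w.re) :
    |((ContinuousLinearMap.toSpanSingleton ℂ (2 * Complex.sinh w)).restrictScalars ℝ).det| •
        chebGram s j k (2 * Complex.cosh w) =
      (stripExp ((j + 1) + (k + 1) - 2 * s) (j - k) +
        stripExp (-(j + 1) - (k + 1) - 2 * s) (k - j) -
        stripExp ((j + 1) - (k + 1) - 2 * s) ((j + 1) + (k + 1)) -
        stripExp ((k + 1) - (j + 1) - 2 * s) (-(j + 1) - (k + 1))) w := by
  rw [abs_det_toSpanSingleton_restrictScalars]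
  have hj := Chebyshev.S_two_mul_complex_cosh w j
  have hk := congrArg star (Chebyshev.S_two_mul_complex_cosh w k)
  rw [Int.cast_natCast] at hj hk
  have e1 : ((linMahler (2 * Complex.cosh w) : ℝ) : ℂ) ^ (-2 * s) =
      Complex.exp (-2 * s * w.re) := by
    rw [linMahler_two_mul_cosh hw, Complex.cpow_def_of_ne_zero (by simp),
      ← Complex.ofReal_log (Real.exp_pos _).le, Real.log_exp]
    ring_nf
  have e2 : ((‖2 * Complex.sinh w‖ ^ 2 : ℝ) : ℂ) =
      (2 * Complex.sinh w) * star (2 * Complex.sinh w) := by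
    push_cast
    exact (Complex.mul_conj' _).symm
  rw [chebGram, e1, Complex.real_smul, e2]
  have e3 : 2 * Complex.sinh w * star (2 * Complex.sinh w) * (Complex.exp (-2 * s * w.re) *
      ((Chebyshev.S ℂ j).eval (2 * Complex.cosh w) *
        star ((Chebyshev.S ℂ k).eval (2 * Complex.cosh w)))) =
      Complex.exp (-2 * s * w.re) * ((2 * Complex.sinh ((j + 1) * w)) *
        (2 * star (Complex.sinh ((k + 1) * w)))) := by
    have hk' := hk
    rw [star_mul'] at hk'
    rw [star_mul', ← hj, ← hk']
    simp only [star_ofNat]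
    ring
  rw [e3]
  have e4 : star (Complex.sinh ((k + 1) * w)) = Complex.sinh ((k + 1) * star w) := by
    rw [Complex.star_def, ← Complex.sinh_conj]
    simp
  have hw1 : w = w.re + w.im * Complex.I := (Complex.re_add_im w).symm
  have hw2 : star w = w.re - w.im * Complex.I := by
    apply Complex.ext <;> simp
  rw [e4, hw2]
  simp only [Pi.sub_apply, Pi.add_apply, stripExp]
  generalize w.re = u at *
  generalize w.im = θ at *
  subst hw1
  have two_sinh (z : ℂ) : 2 * Complex.sinh z = Complex.exp z - Complex.exp (-z) := by
    rw [Complex.sinh]; ring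
  rw [two_sinh, two_sinh]
  simp only [mul_sub, sub_mul, ← Complex.exp_add]
  push_cast
  ring_nf

/-- The four exponents occurring in `chebGram_two_mul_cosh` have negative real part. -/
lemma chebGram_exponents_re_neg {N : ℕ} {s : ℂ} {j k : ℕ} (hs : (N : ℝ) < s.re)
    (hj : j < N) (hk : k < N) :
    ((j + 1) + (k + 1) - 2 * s : ℂ).re < 0 ∧ (-(j + 1) - (k + 1) - 2 * s : ℂ).re < 0 ∧
      ((j + 1) - (k + 1) - 2 * s : ℂ).re < 0 ∧ ((k + 1) - (j + 1) - 2 * s : ℂ).re < 0 := by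
  have hj' : (j : ℝ) + 1 ≤ N := by exact_mod_cast hj
  have hk' : (k : ℝ) + 1 ≤ N := by exact_mod_cast hk
  have hj0 : (0 : ℝ) ≤ j := by positivity
  have hk0 : (0 : ℝ) ≤ k := by positivity
  refine ⟨?_, ?_, ?_, ?_⟩ <;> simp <;> linarith

lemma chebGram_comp_integrableOn {N : ℕ} {s : ℂ} {j k : ℕ} (hs : (N : ℝ) < s.re)
    (hj : j < N) (hk : k < N) :
    IntegrableOn (fun w => |((ContinuousLinearMap.toSpanSingleton ℂ
      (2 * Complex.sinh w)).restrictScalars ℝ).det| • chebGram s j k (2 * Complex.cosh w))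
      halfStrip := by
  obtain ⟨h1, h2, h3, h4⟩ := chebGram_exponents_re_neg hs hj hk
  rw [integrableOn_congr_fun (fun w hw => chebGram_two_mul_cosh s j k (le_of_lt hw.1))
    measurableSet_halfStrip]
  exact (((stripExp_integrableOn h1 _).add (stripExp_integrableOn h2 _)).sub
    (stripExp_integrableOn h3 _)).sub (stripExp_integrableOn h4 _)

lemma integrable_chebGram {N : ℕ} {s : ℂ} {j k : ℕ} (hs : (N : ℝ) < s.re)
    (hj : j < N) (hk : k < N) :
    Integrable (chebGram s j k) := by
  rw [integrable_iff_integrableOn_of_compl_null _ volume_compl_image_two_mul_cosh,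
    integrableOn_image_iff_integrableOn_abs_det_fderiv_smul volume measurableSet_halfStrip
      (fun w _ => (hasFDerivAt_two_mul_cosh w).hasFDerivWithinAt) two_mul_cosh_injOn]
  exact chebGram_comp_integrableOn hs hj hk

/-- The Chebyshev polynomials of the second kind are orthogonal for the weight
`linMahler ^ (-2 s)`. -/
lemma integral_chebGram {N : ℕ} {s : ℂ} {j k : ℕ} (hs : (N : ℝ) < s.re)
    (hj : j < N) (hk : k < N) :
    ∫ β, chebGram s j k β =
      if j = k then 2 * (Real.pi : ℂ) * s / (s ^ 2 - ((j : ℂ) + 1) ^ 2) else 0 := by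
  rw [integral_eq_setIntegral_of_compl_null _ volume_compl_image_two_mul_cosh,
    integral_image_eq_integral_abs_det_fderiv_smul volume measurableSet_halfStrip
      (fun w _ => (hasFDerivAt_two_mul_cosh w).hasFDerivWithinAt) two_mul_cosh_injOn]
  obtain ⟨h1, h2, h3, h4⟩ := chebGram_exponents_re_neg hs hj hk
  rw [setIntegral_congr_fun measurableSet_halfStrip
    fun w hw => chebGram_two_mul_cosh s j k (le_of_lt hw.1)]
  have i1 := stripExp_integrableOn h1 (j - k)
  have i2 := stripExp_integrableOn h2 (k - j)
  have i3 := stripExp_integrableOn h3 ((j + 1) + (k + 1))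
  have i4 := stripExp_integrableOn h4 (-(j + 1) - (k + 1))
  rw [integral_sub' ((i1.add i2).sub i3) i4, integral_sub' (i1.add i2) i3, integral_add' i1 i2,
    integral_stripExp h1, integral_stripExp h2, integral_stripExp h3, integral_stripExp h4,
    if_neg (show ((j : ℤ) + 1) + (k + 1) ≠ 0 by omega),
    if_neg (show -((j : ℤ) + 1) - (k + 1) ≠ 0 by omega)]
  by_cases hjk : j = k
  · subst hjk
    have a1 : s - (j + 1) ≠ 0 := fun h => by
      rw [show ((j + 1) + (j + 1) - 2 * s : ℂ) = -2 * (s - (j + 1)) by ring, h] at h1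
      simp at h1
    have a2 : s + (j + 1) ≠ 0 := fun h => by
      rw [show (-(j + 1) - (j + 1) - 2 * s : ℂ) = -2 * (s + (j + 1)) by ring, h] at h2
      simp at h2
    rw [show ((j + 1) + (j + 1) - 2 * s : ℂ) = -2 * (s - (j + 1)) by ring,
      show (-(j + 1) - (j + 1) - 2 * s : ℂ) = -2 * (s + (j + 1)) by ring,
      show s ^ 2 - ((j : ℂ) + 1) ^ 2 = (s - (j + 1)) * (s + (j + 1)) by ring]
    simp only [sub_self, if_true, sub_zero]
    field_simp
    ring
  · rw [if_neg (show ((j : ℤ) - k) ≠ 0 by omega), if_neg (show ((k : ℤ) - j) ≠ 0 by omega),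
      if_neg hjk]
    simp

/-! ### The Mahler measure in terms of the roots -/

lemma laurentEval_reciprocalLaurent {N : ℕ} (b : Fin N → ℂ) (x : ℂˣ) :
    laurentEval (reciprocalLaurent (Fin.snoc b 1 : Fin (N + 1) → ℂ)) x =
      (recPoly b).eval ((x : ℂ) + (x : ℂ)⁻¹) := by
  have h : ∀ v : Fin (N + 1) → ℂ, laurentEval (reciprocalLaurent v) x =
      ∑ m : Fin (N + 1), v m * (chebBasis m).eval ((x : ℂ) + (x : ℂ)⁻¹) := by
    intro v
    rw [Fin.sum_univ_succ, laurentEval, reciprocalLaurent]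
    simp only [map_add, map_sum, map_mul, LaurentPolynomial.eval₂_C, LaurentPolynomial.eval₂_T,
      Fin.val_zero, chebBasis_zero, eval_one, mul_one, RingHom.id_apply, Fin.val_succ]
    congr 1
    refine Finset.sum_congr rfl fun n _ => ?_
    rw [chebBasis_succ_eval_add_inv _ x.ne_zero, zpow_neg,
      show ((n : ℕ) : ℤ) + 1 = ((n + 1 : ℕ) : ℤ) by push_cast; rfl, zpow_natCast]
    simp
  rw [h, Fin.sum_univ_castSucc, recPoly_eval]
  simp only [Fin.snoc_castSucc, Fin.snoc_last, Fin.val_castSucc, Fin.val_last, one_mul]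
  rw [add_comm]
  exact congrArg _ (Finset.sum_congr rfl fun n _ => mul_comm _ _)

lemma reciprocalLaurent_snoc_ne_zero {N : ℕ} (b : Fin N → ℂ) :
    reciprocalLaurent (Fin.snoc b 1 : Fin (N + 1) → ℂ) ≠ 0 := by
  intro h
  obtain ⟨z, hz⟩ : ∃ z, (recPoly b).eval z ≠ 0 := by
    by_contra! h0
    exact (recPoly_monic b).ne_zero (Polynomial.funext (by simpa using h0))
  obtain ⟨x, hx0, hx⟩ := exists_add_inv_eq z
  have := laurentEval_reciprocalLaurent b (Units.mk0 x hx0)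
  rw [h, Units.val_mk0, hx] at this
  exact hz (by rw [← this]; simp [laurentEval])

lemma Polynomial.mahlerMeasure_finsetProd {ι : Type*} (t : Finset ι) (p : ι → ℂ[X]) :
    (∏ i ∈ t, p i).mahlerMeasure = ∏ i ∈ t, (p i).mahlerMeasure := by
  classical
  induction t using Finset.induction_on with
  | empty => simp
  | insert a t ha ih => rw [Finset.prod_insert ha, Finset.prod_insert ha, mahlerMeasure_mul, ih]

/-- The Mahler measure is the product over the roots `β i` of `P_b`. On the unit circle
`∏ (x + x⁻¹ - β i)` and `∏ (x² - β i x + 1)` have the same absolute value. -/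
lemma monicRecMahler_coeffOfRoots {N : ℕ} (β : Fin N → ℂ) :
    monicRecMahler (coeffOfRoots β) = ∏ i, linMahler (β i) := by
  have hm : (∏ i, (X ^ 2 - C (β i) * X + 1 : ℂ[X])) ≠ 0 :=
    Finset.prod_ne_zero_iff.mpr fun i _ => (linMahler_poly_monic (β i)).ne_zero
  rw [monicRecMahler, recMahler, laurentMahlerMeasure, if_neg (reciprocalLaurent_snoc_ne_zero _)]
  simp only [linMahler]
  rw [← mahlerMeasure_finsetProd, mahlerMeasure_def_of_ne_zero hm]
  congr 1
  have h : ∀ t : ℝ, Real.log ‖laurentEval (reciprocalLaurent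
      (Fin.snoc (coeffOfRoots β) 1 : Fin (N + 1) → ℂ)) (unitCirclePoint t)‖ =
      Real.log ‖eval (circleMap 0 1 (2 * Real.pi * t)) (∏ i, (X ^ 2 - C (β i) * X + 1 : ℂ[X]))‖ := by
    intro t
    have hx : ((unitCirclePoint t : ℂˣ) : ℂ) = circleMap 0 1 (2 * Real.pi * t) := by
      simp [unitCirclePoint, circleMap]
      ring_nf
    have hn : ‖circleMap 0 1 (2 * Real.pi * t)‖ = 1 := by simp
    rw [laurentEval_reciprocalLaurent, recPoly_coeffOfRoots, hx]
    generalize circleMap 0 1 (2 * Real.pi * t) = x at hn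
    have h0 : x ≠ 0 := by rintro rfl; simp at hn
    simp only [eval_prod, norm_prod, eval_sub, eval_X, eval_C, eval_add, eval_pow, eval_mul,
      eval_one]
    congr 1
    refine Finset.prod_congr rfl fun i _ => ?_
    rw [show x ^ 2 - β i * x + 1 = x * (x + x⁻¹ - β i) by field_simp; ring, norm_mul, hn, one_mul]
  simp only [h]
  rw [intervalIntegral.integral_comp_mul_left
    (fun θ => Real.log ‖eval (circleMap 0 1 θ) (∏ i, (X ^ 2 - C (β i) * X + 1 : ℂ[X]))‖)
    (by positivity)]
  simp

/-! ### The integral over the roots -/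

/-- The integrand after the change of variables from coefficients to roots. -/
noncomputable def rootDensity {N : ℕ} (s : ℂ) (β : Fin N → ℂ) : ℂ :=
  ‖(Matrix.vandermonde β).det‖ ^ 2 • (∏ i, (linMahler (β i) : ℂ) ^ (-2 * s))

lemma ofReal_prod_cpow {N : ℕ} (a : Fin N → ℝ) (ha : ∀ i, 0 < a i) (z : ℂ) :
    ((∏ i, a i : ℝ) : ℂ) ^ z = ∏ i, (a i : ℂ) ^ z := by
  induction N with
  | zero => simp
  | succ n ih =>
    rw [Fin.prod_univ_succ, Fin.prod_univ_succ, Complex.ofReal_mul,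
      Complex.mul_cpow_ofReal_nonneg (ha 0).le (Finset.prod_nonneg fun i _ => (ha i.succ).le),
      ih _ fun i => ha i.succ]

/-- The Vandermonde determinant does not change when the powers are replaced by the monic polynomials
`S_j`, which are orthogonal for the relevant weight. -/
lemma det_vandermonde_eq_sum_chebyshevS {N : ℕ} (β : Fin N → ℂ) : (Matrix.vandermonde β).det =
    ∑ σ : Equiv.Perm (Fin N), ((Equiv.Perm.sign σ : ℤ) : ℂ) *
      ∏ i, (Chebyshev.S ℂ ((σ i : ℕ) : ℤ)).eval (β i) := by
  rw [Matrix.det_eval_matrixOfPolynomials_eq_det_vandermonde β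
    (fun j => Chebyshev.S ℂ ((j : ℕ) : ℤ)) (fun j => (chebyshevS_monic_natDegree j).2)
    (fun j => (chebyshevS_monic_natDegree j).1), ← Matrix.det_transpose, Matrix.det_apply']
  rfl

/-- Expanding both determinants makes `rootDensity` a sum of products of functions of one root. -/
lemma rootDensity_eq_sum {N : ℕ} (s : ℂ) (β : Fin N → ℂ) : rootDensity s β =
    ∑ σ : Equiv.Perm (Fin N), ∑ τ : Equiv.Perm (Fin N),
      (((Equiv.Perm.sign σ : ℤ) : ℂ) * ((Equiv.Perm.sign τ : ℤ) : ℂ)) *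
        ∏ i, chebGram s (σ i) (τ i) (β i) := by
  have e2 : ((‖(Matrix.vandermonde β).det‖ ^ 2 : ℝ) : ℂ) =
      (Matrix.vandermonde β).det * star (Matrix.vandermonde β).det := by
    push_cast
    exact (Complex.mul_conj' _).symm
  rw [rootDensity, Complex.real_smul, e2, det_vandermonde_eq_sum_chebyshevS, star_sum,
    Finset.sum_mul_sum, Finset.sum_mul]
  refine Finset.sum_congr rfl fun σ _ => ?_
  rw [Finset.sum_mul]
  refine Finset.sum_congr rfl fun τ _ => ?_
  simp only [chebGram, Finset.prod_mul_distrib]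
  rw [star_mul', star_prod, star_intCast]
  ring

lemma integrable_rootDensity_term {N : ℕ} {s : ℂ} (hs : (N : ℝ) < s.re) (σ τ : Equiv.Perm (Fin N)) :
    Integrable (fun β : Fin N → ℂ => (((Equiv.Perm.sign σ : ℤ) : ℂ) *
      ((Equiv.Perm.sign τ : ℤ) : ℂ)) * ∏ i, chebGram s (σ i) (τ i) (β i)) :=
  (Integrable.fintype_prod_dep fun i => integrable_chebGram hs (σ i).2 (τ i).2).const_mul _

lemma integrable_rootDensity {N : ℕ} {s : ℂ} (hs : (N : ℝ) < s.re) :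
    Integrable (rootDensity s : (Fin N → ℂ) → ℂ) := by
  simp_rw [funext (rootDensity_eq_sum s)]
  exact integrable_finsetSum _ fun σ _ => integrable_finsetSum _ fun τ _ =>
    integrable_rootDensity_term hs σ τ

/-- Only the diagonal terms of the double sum over permutations survive, by orthogonality. -/
lemma integral_rootDensity {N : ℕ} {s : ℂ} (hs : (N : ℝ) < s.re) :
    ∫ β : Fin N → ℂ, rootDensity s β =
    (N.factorial : ℂ) * ∏ j : Fin N, (2 * (Real.pi : ℂ) * s / (s ^ 2 - (((j : ℕ) : ℂ) + 1) ^ 2)) := by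
  simp_rw [rootDensity_eq_sum s]
  rw [integral_finsetSum _ fun σ _ => integrable_finsetSum _ fun τ _ =>
    integrable_rootDensity_term hs σ τ]
  have h : ∀ σ : Equiv.Perm (Fin N), ∫ β : Fin N → ℂ, ∑ τ : Equiv.Perm (Fin N),
      (((Equiv.Perm.sign σ : ℤ) : ℂ) * ((Equiv.Perm.sign τ : ℤ) : ℂ)) *
        ∏ i, chebGram s (σ i) (τ i) (β i) =
      ∏ j : Fin N, (2 * (Real.pi : ℂ) * s / (s ^ 2 - (((j : ℕ) : ℂ) + 1) ^ 2)) := by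
    intro σ
    rw [integral_finsetSum _ fun τ _ => integrable_rootDensity_term hs σ τ]
    have ht : ∀ τ : Equiv.Perm (Fin N), ∫ β : Fin N → ℂ,
        (((Equiv.Perm.sign σ : ℤ) : ℂ) * ((Equiv.Perm.sign τ : ℤ) : ℂ)) *
          ∏ i, chebGram s (σ i) (τ i) (β i) =
        (((Equiv.Perm.sign σ : ℤ) : ℂ) * ((Equiv.Perm.sign τ : ℤ) : ℂ)) *
          ∏ i, if ((σ i : Fin N) : ℕ) = τ i then
            2 * (Real.pi : ℂ) * s / (s ^ 2 - (((σ i : ℕ) : ℂ) + 1) ^ 2) else 0 := by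
      intro τ
      rw [integral_const_mul, integral_fintype_prod_volume_eq_prod
        (fun i z => chebGram s (σ i) (τ i) z)]
      simp_rw [integral_chebGram hs (σ _).2 (τ _).2]
    simp_rw [ht]
    rw [Finset.sum_eq_single σ]
    · rw [← Int.cast_mul, ← Units.val_mul, Int.units_mul_self]
      simp only [if_true, Units.val_one, Int.cast_one, one_mul]
      exact Equiv.prod_comp σ
        fun j : Fin N => 2 * (Real.pi : ℂ) * s / (s ^ 2 - (((j : ℕ) : ℂ) + 1) ^ 2)
    · intro τ _ hτ
      obtain ⟨i, hi⟩ : ∃ i, σ i ≠ τ i := by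
        by_contra! h
        exact hτ (Equiv.ext fun i => (h i).symm)
      rw [Finset.prod_eq_zero (Finset.mem_univ i), mul_zero]
      rw [if_neg]
      rwa [Ne, Fin.ext_iff] at hi
    · simp
  simp_rw [h]
  simp [Fintype.card_perm]

lemma rootDensity_comp_perm {N : ℕ} (s : ℂ) (β : Fin N → ℂ) (σ : Equiv.Perm (Fin N)) :
    rootDensity s (β ∘ σ) = rootDensity s β := by
  have h1 : Matrix.vandermonde (β ∘ σ) = (Matrix.vandermonde β).submatrix σ id := by
    ext i j; simp [Matrix.vandermonde_apply]
  have h2 : ‖(((Equiv.Perm.sign σ : ℤ) : ℂ))‖ = 1 := by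
    rcases Int.units_eq_one_or (Equiv.Perm.sign σ) with h | h <;> simp [h]
  rw [rootDensity, rootDensity, h1, Matrix.det_permute, norm_mul, h2, one_mul]
  congr 1
  exact Equiv.prod_comp σ fun i => (linMahler (β i) : ℂ) ^ (-2 * s)

/-! ### Sorted roots -/

/-- The root vectors with strictly increasing real parts: a fundamental domain, up to a null set,
for the permutations of the roots. -/
def sortedRoots (N : ℕ) : Set (Fin N → ℂ) := {β | StrictMono fun i => (β i).re}

/-- The root vectors that become sorted after the permutation `σ`. -/
def permRoots {N : ℕ} (σ : Equiv.Perm (Fin N)) : Set (Fin N → ℂ) := {β | β ∘ σ ∈ sortedRoots N}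

lemma measurableSet_sortedRoots (N : ℕ) : MeasurableSet (sortedRoots N) := by
  have : sortedRoots N = ⋂ (i : Fin N) (j : Fin N) (_ : i < j), {β | (β i).re < (β j).re} := by
    ext β; simp [sortedRoots, StrictMono]
  rw [this]
  refine MeasurableSet.iInter fun i => MeasurableSet.iInter fun j => MeasurableSet.iInter fun _ => ?_
  exact measurableSet_lt (by fun_prop) (by fun_prop)

lemma piCongrLeft_symm_eq_comp {N : ℕ} (σ : Equiv.Perm (Fin N)) :
    ⇑(MeasurableEquiv.piCongrLeft (fun _ : Fin N => ℂ) σ.symm) = fun β => β ∘ σ := by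
  funext β i
  have := Equiv.piCongrLeft_apply_apply (fun _ : Fin N => ℂ) σ.symm β (σ i)
  simp only [Equiv.symm_apply_apply] at this
  exact this

lemma measurePreserving_comp_perm {N : ℕ} (σ : Equiv.Perm (Fin N)) :
    MeasurePreserving (fun β : Fin N → ℂ => β ∘ σ) := by
  rw [← piCongrLeft_symm_eq_comp]
  exact volume_measurePreserving_piCongrLeft (fun _ : Fin N => ℂ) σ.symm

lemma measurableSet_permRoots {N : ℕ} (σ : Equiv.Perm (Fin N)) : MeasurableSet (permRoots σ) :=
  (measurePreserving_comp_perm σ).measurable (measurableSet_sortedRoots N)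

lemma setIntegral_permRoots {N : ℕ} (s : ℂ) (σ : Equiv.Perm (Fin N)) :
    ∫ β in permRoots σ, rootDensity s β = ∫ β in sortedRoots N, rootDensity s β := by
  have hemb : MeasurableEmbedding (fun β : Fin N → ℂ => β ∘ σ) := by
    rw [← piCongrLeft_symm_eq_comp]
    exact (MeasurableEquiv.piCongrLeft (fun _ : Fin N => ℂ) σ.symm).measurableEmbedding
  have h := (measurePreserving_comp_perm σ).setIntegral_preimage_emb hemb (rootDensity s)
    (sortedRoots N)
  simp_rw [rootDensity_comp_perm] at h
  exact h

lemma perm_eq_of_mem_permRoots {N : ℕ} {σ τ : Equiv.Perm (Fin N)} {β : Fin N → ℂ}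
    (hσ : β ∈ permRoots σ) (hτ : β ∈ permRoots τ) : σ = τ := by
  have h : (fun i => (β (σ i)).re) = fun i => (β (τ i)).re := by
    refine (StrictMono.range_inj hσ hτ).mp ?_
    exact (σ.surjective.range_comp fun i => (β i).re).trans
      (τ.surjective.range_comp fun i => (β i).re).symm
  have hinj : Function.Injective fun i => (β i).re := by
    have := (StrictMono.injective hσ).comp σ.symm.injective
    simpa [Function.comp_def] using this
  exact Equiv.ext fun i => hinj (congrFun h i)

lemma exists_mem_permRoots {N : ℕ} {β : Fin N → ℂ} (h : Function.Injective fun i => (β i).re) :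
    ∃ σ, β ∈ permRoots σ :=
  ⟨Tuple.sort fun i => (β i).re, (Tuple.monotone_sort _).strictMono_of_injective
    (h.comp (Equiv.injective _))⟩

lemma volume_not_injective_re (N : ℕ) :
    volume {β : Fin N → ℂ | ¬ Function.Injective fun i => (β i).re} = 0 := by
  have hsub : {β : Fin N → ℂ | ¬ Function.Injective fun i => (β i).re} ⊆
      ⋃ p : {p : Fin N × Fin N // p.1 ≠ p.2}, (LinearMap.ker (Complex.reLm ∘ₗ
        ((LinearMap.proj p.1.1 : (Fin N → ℂ) →ₗ[ℝ] ℂ) - LinearMap.proj p.1.2)) :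
          Set (Fin N → ℂ)) := by
    intro β hβ
    simp only [Set.mem_ofPred_eq, Function.Injective, not_forall] at hβ
    obtain ⟨i, j, hij, hne⟩ := hβ
    refine Set.mem_iUnion.mpr ⟨⟨(i, j), hne⟩, ?_⟩
    simpa [sub_eq_zero] using hij
  refine measure_mono_null hsub (measure_iUnion_null fun p => Measure.addHaar_submodule _ _ ?_)
  obtain ⟨⟨i, j⟩, hne⟩ := p
  intro h
  have : (Pi.single i 1 : Fin N → ℂ) ∈ LinearMap.ker (Complex.reLm ∘ₗ
        ((LinearMap.proj i : (Fin N → ℂ) →ₗ[ℝ] ℂ) - LinearMap.proj j)) := by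
    rw [h]; trivial
  simp [Ne.symm hne] at this

/-- The integral over the fundamental domain is the `N!`-th part of the integral over all roots, by
symmetry. -/
lemma setIntegral_sortedRoots {N : ℕ} {s : ℂ} (hs : (N : ℝ) < s.re) :
    ∫ β in sortedRoots N, rootDensity s β =
      ∏ j : Fin N, (2 * (Real.pi : ℂ) * s / (s ^ 2 - (((j : ℕ) : ℂ) + 1) ^ 2)) := by
  have hnull : volume (⋃ σ : Equiv.Perm (Fin N), permRoots σ)ᶜ = 0 := by
    refine measure_mono_null ?_ (volume_not_injective_re N)
    exact fun β hβ hinj => hβ (Set.mem_iUnion.mpr (exists_mem_permRoots hinj))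
  have h := integral_rootDensity hs
  rw [integral_eq_setIntegral_of_compl_null _ hnull, integral_iUnion_fintype
    (fun σ => measurableSet_permRoots σ)
    (fun σ τ hne => Set.disjoint_left.mpr fun β h1 h2 => hne (perm_eq_of_mem_permRoots h1 h2))
    (fun σ => (integrable_rootDensity hs).integrableOn)] at h
  simp_rw [setIntegral_permRoots] at h
  simp only [Finset.sum_const, Finset.card_univ, Fintype.card_perm, Fintype.card_fin,
    nsmul_eq_mul] at h
  exact mul_left_cancel₀ (by exact_mod_cast N.factorial_ne_zero) h

/-! ### The change of variables from coefficients to roots -/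

lemma coeffOfRoots_comp_perm {N : ℕ} (β : Fin N → ℂ) (σ : Equiv.Perm (Fin N)) :
    coeffOfRoots (β ∘ σ) = coeffOfRoots β := by
  apply recPoly_injective
  rw [recPoly_coeffOfRoots, recPoly_coeffOfRoots]
  exact Equiv.prod_comp σ fun i => X - C (β i)

lemma mem_range_of_coeffOfRoots_eq {N : ℕ} {β γ : Fin N → ℂ} (h : coeffOfRoots β = coeffOfRoots γ)
    (i : Fin N) : ∃ j, γ j = β i := by
  have h1 : ∏ k, (X - C (β k)) = ∏ k, (X - C (γ k)) := by
    rw [← recPoly_coeffOfRoots, h, recPoly_coeffOfRoots]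
  have h2 := congrArg (eval (β i)) h1
  rw [eval_prod, eval_prod, Finset.prod_eq_zero (Finset.mem_univ i) (by simp), eq_comm,
    Finset.prod_eq_zero_iff] at h2
  obtain ⟨j, -, hj⟩ := h2
  exact ⟨j, by simpa [sub_eq_zero, eq_comm] using hj⟩

lemma coeffOfRoots_injOn_sortedRoots (N : ℕ) : Set.InjOn coeffOfRoots (sortedRoots N) := by
  intro β hβ γ hγ h
  have hre : (fun i => (β i).re) = fun i => (γ i).re := by
    refine (StrictMono.range_inj hβ hγ).mp (Set.Subset.antisymm ?_ ?_)
    · rintro _ ⟨i, rfl⟩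
      obtain ⟨j, hj⟩ := mem_range_of_coeffOfRoots_eq h i
      exact ⟨j, by simp [hj]⟩
    · rintro _ ⟨i, rfl⟩
      obtain ⟨j, hj⟩ := mem_range_of_coeffOfRoots_eq h.symm i
      exact ⟨j, by simp [hj]⟩
  funext i
  obtain ⟨j, hj⟩ := mem_range_of_coeffOfRoots_eq h i
  have : j = i := (StrictMono.injective hγ) <| by
    change (γ j).re = (γ i).re
    rw [hj]; exact congrFun hre i
  rw [← hj, this]

/-- The coefficient vectors missed by sorted roots come from roots two of which have the same real
part, and a differentiable map sends null sets to null sets. -/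
lemma volume_compl_image_coeffOfRoots (N : ℕ) :
    volume (coeffOfRoots '' sortedRoots N)ᶜ = 0 := by
  refine measure_mono_null (t := coeffOfRoots ''
    {β : Fin N → ℂ | ¬ Function.Injective fun i => (β i).re}) ?_ ?_
  · intro b hb
    obtain ⟨β, rfl⟩ := coeffOfRoots_surjective b
    refine ⟨β, fun hinj => hb ?_, rfl⟩
    obtain ⟨σ, hσ⟩ := exists_mem_permRoots hinj
    exact ⟨β ∘ σ, hσ, coeffOfRoots_comp_perm β σ⟩
  · exact addHaar_image_eq_zero_of_differentiableOn_of_addHaar_eq_zero volume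
      ((differentiable_coeffOfRoots N).restrictScalars ℝ).differentiableOn
      (volume_not_injective_re N)

/-- The change of variables turns the integrand of `recMahlerIntegral` into `rootDensity`. -/
lemma abs_det_smul_monicRecMahler_cpow {N : ℕ} (s : ℂ) {β : Fin N → ℂ} (hβ : β ∈ sortedRoots N) :
    |((fderiv ℂ coeffOfRoots β).restrictScalars ℝ).det| •
      ((monicRecMahler (coeffOfRoots β) : ℝ) : ℂ) ^ (-2 * s) = rootDensity s β := by
  have hinj : Function.Injective β := fun i j hij =>
    (StrictMono.injective hβ) (congrArg Complex.re hij)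
  rw [abs_det_fderiv_coeffOfRoots hinj, monicRecMahler_coeffOfRoots,
    ofReal_prod_cpow _ fun i => linMahler_pos _, rootDensity]

lemma hasFDerivWithinAt_coeffOfRoots {N : ℕ} (β : Fin N → ℂ) (S : Set (Fin N → ℂ)) :
    HasFDerivWithinAt coeffOfRoots ((fderiv ℂ coeffOfRoots β).restrictScalars ℝ) S β :=
  (((differentiable_coeffOfRoots N) β).hasFDerivAt.restrictScalars ℝ).hasFDerivWithinAt

lemma integrable_monicRecMahler_cpow {N : ℕ} {s : ℂ} (hs : (N : ℝ) < s.re) :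
    Integrable (fun b : Fin N → ℂ => ((monicRecMahler b : ℝ) : ℂ) ^ (-2 * s)) := by
  rw [integrable_iff_integrableOn_of_compl_null _ (volume_compl_image_coeffOfRoots N),
    integrableOn_image_iff_integrableOn_abs_det_fderiv_smul volume (measurableSet_sortedRoots N)
      (fun β _ => hasFDerivWithinAt_coeffOfRoots β _) (coeffOfRoots_injOn_sortedRoots N),
    integrableOn_congr_fun (fun β hβ => abs_det_smul_monicRecMahler_cpow s hβ)
      (measurableSet_sortedRoots N)]
  exact (integrable_rootDensity hs).integrableOn

lemma recMahlerIntegral_eq {N : ℕ} {s : ℂ} (hs : (N : ℝ) < s.re) : recMahlerIntegral N s =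
    ∏ j : Fin N, (2 * (Real.pi : ℂ) * s / (s ^ 2 - (((j : ℕ) : ℂ) + 1) ^ 2)) := by
  rw [recMahlerIntegral, integral_eq_setIntegral_of_compl_null _ (volume_compl_image_coeffOfRoots N),
    integral_image_eq_integral_abs_det_fderiv_smul volume (measurableSet_sortedRoots N)
      (fun β _ => hasFDerivWithinAt_coeffOfRoots β _) (coeffOfRoots_injOn_sortedRoots N),
    setIntegral_congr_fun (measurableSet_sortedRoots N)
      (fun β hβ => abs_det_smul_monicRecMahler_cpow s hβ), setIntegral_sortedRoots hs]

/-! ### The rational function and the analytic continuation -/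

/-- Where numerator and denominator have no common zero, `RatFunc.eval` of a fraction is the quotient
of the values. At a pole both sides are `0`, the value of a division by zero. -/
lemma ratFunc_eval_div {p q : ℂ[X]} (hq : q ≠ 0) {z : ℂ} (h : q.eval z = 0 → p.eval z ≠ 0) :
    (algebraMap ℂ[X] (RatFunc ℂ) p / algebraMap ℂ[X] (RatFunc ℂ) q).eval (RingHom.id ℂ) z =
      p.eval z / q.eval z := by
  set x := algebraMap ℂ[X] (RatFunc ℂ) p / algebraMap ℂ[X] (RatFunc ℂ) q with hx
  have h1 := congrArg (eval z) ((RatFunc.num_mul_eq_mul_denom_iff hq).mpr hx)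
  rw [eval_mul, eval_mul] at h1
  rw [RatFunc.eval, eval₂_id, eval₂_id]
  obtain ⟨a, b, hab⟩ := RatFunc.isCoprime_num_denom x
  have h2 := congrArg (eval z) hab
  rw [eval_add, eval_mul, eval_mul, eval_one] at h2
  by_cases hqz : q.eval z = 0
  · rw [hqz, mul_zero, eq_comm, mul_eq_zero] at h1
    rw [h1.resolve_left (h hqz), hqz, div_zero, div_zero]
  · have hd : x.denom.eval z ≠ 0 := by
      intro hd
      rw [hd, mul_zero, mul_eq_zero] at h1
      rw [hd, h1.resolve_right hqz] at h2
      simp at h2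
    rw [div_eq_div_iff hd hqz, h1]

lemma sq_sub_natCast_sq_eq_zero_iff (s : ℂ) (n : ℕ) :
    s ^ 2 - (n : ℂ) ^ 2 = 0 ↔ s = n ∨ s = -n := by
  rw [sub_eq_zero, sq_eq_sq_iff_eq_or_eq_neg]

/-- As `s = 0` is not a zero of the denominators, this holds at the poles as well, so that the
parity of the rational function needs no exception there. -/
lemma ratFunc_prod_eval (N : ℕ) (s : ℂ) : (∏ n ∈ Finset.Icc 1 N,
      (RatFunc.C (2 * (Real.pi : ℂ)) * RatFunc.X) / (RatFunc.X ^ 2 - RatFunc.C ((n : ℂ) ^ 2)) :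
        RatFunc ℂ).eval (RingHom.id ℂ) s =
    ∏ n ∈ Finset.Icc 1 N, 2 * (Real.pi : ℂ) * s / (s ^ 2 - (n : ℂ) ^ 2) := by
  have h : (∏ n ∈ Finset.Icc 1 N,
      (RatFunc.C (2 * (Real.pi : ℂ)) * RatFunc.X) / (RatFunc.X ^ 2 - RatFunc.C ((n : ℂ) ^ 2)) :
        RatFunc ℂ) =
      algebraMap ℂ[X] (RatFunc ℂ) (∏ _n ∈ Finset.Icc 1 N, (C (2 * (Real.pi : ℂ)) * X)) /
      algebraMap ℂ[X] (RatFunc ℂ) (∏ n ∈ Finset.Icc 1 N, (X ^ 2 - C ((n : ℂ) ^ 2))) := by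
    rw [Finset.prod_div_distrib, map_prod, map_prod]
    congr 1 <;> refine Finset.prod_congr rfl fun n _ => ?_ <;>
      simp only [map_mul, map_sub, map_pow, RatFunc.algebraMap_C, RatFunc.algebraMap_X]
  rw [h, ratFunc_eval_div]
  · simp [eval_prod, Finset.prod_div_distrib]
  · exact Finset.prod_ne_zero_iff.mpr fun n _ => X_pow_sub_C_ne_zero two_pos _
  · intro hz
    rw [eval_prod, Finset.prod_eq_zero_iff] at hz
    obtain ⟨n, hn, hz⟩ := hz
    -- A zero of the denominators is some `± n` with `1 ≤ n`, so it is not a zero of the numerators.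
    have hn1 := (Finset.mem_Icc.mp hn).1
    have hn0 : (n : ℂ) ≠ 0 := by exact_mod_cast (by omega : n ≠ 0)
    have hs : s ≠ 0 := by
      simp only [eval_sub, eval_pow, eval_X, eval_C, sq_sub_natCast_sq_eq_zero_iff] at hz
      rcases hz with rfl | rfl
      · exact hn0
      · exact neg_ne_zero.mpr hn0
    rw [eval_prod]
    refine Finset.prod_ne_zero_iff.mpr fun _ _ => ?_
    simp [hs, Real.pi_ne_zero]

lemma prod_Icc_neg (N : ℕ) (s : ℂ) :
    ∏ n ∈ Finset.Icc 1 N, 2 * (Real.pi : ℂ) * (-s) / ((-s) ^ 2 - (n : ℂ) ^ 2) =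
      (-1) ^ N * ∏ n ∈ Finset.Icc 1 N, 2 * (Real.pi : ℂ) * s / (s ^ 2 - (n : ℂ) ^ 2) := by
  have h : ∀ n : ℕ, 2 * (Real.pi : ℂ) * (-s) / ((-s) ^ 2 - (n : ℂ) ^ 2) =
      (-1) * (2 * (Real.pi : ℂ) * s / (s ^ 2 - (n : ℂ) ^ 2)) := fun n => by
    rw [neg_sq]; ring
  simp_rw [h, Finset.prod_mul_distrib]
  simp

lemma recMahlerIntegral_eq_prod_Icc {N : ℕ} {s : ℂ} (hs : (N : ℝ) < s.re) :
    recMahlerIntegral N s = ∏ n ∈ Finset.Icc 1 N, 2 * (Real.pi : ℂ) * s / (s ^ 2 - (n : ℂ) ^ 2) := by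
  rw [recMahlerIntegral_eq hs,
    Fin.prod_univ_eq_prod_range (fun j : ℕ => 2 * (Real.pi : ℂ) * s / (s ^ 2 - ((j : ℂ) + 1) ^ 2)),
    Finset.range_eq_Ico, ← Finset.Ico_succ_right_eq_Icc, Finset.prod_Ico_eq_prod_range,
    Finset.prod_Ico_eq_prod_range]
  refine Finset.prod_congr (by simp) fun j _ => ?_
  push_cast
  ring_nf

lemma setOf_ne_poles_eq (N : ℕ) :
    {s : ℂ | ∀ n ∈ Finset.Icc 1 N, s ≠ (n : ℂ) ∧ s ≠ -(n : ℂ)} =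
      (⋃ n ∈ Finset.Icc 1 N, {(n : ℂ), -(n : ℂ)})ᶜ := by
  ext s; simp

lemma finite_poles (N : ℕ) : (⋃ n ∈ Finset.Icc 1 N, {(n : ℂ), -(n : ℂ)}).Finite :=
  (Finset.finite_toSet _).biUnion fun _ _ => Set.toFinite _

lemma isAnalyticContinuation_recMahlerIntegral (N : ℕ) :
    IsAnalyticContinuation (recMahlerIntegral N) {s : ℂ | (N : ℝ) < s.re}
      (fun s => ∏ n ∈ Finset.Icc 1 N, 2 * (Real.pi : ℂ) * s / (s ^ 2 - (n : ℂ) ^ 2))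
      {s : ℂ | ∀ n ∈ Finset.Icc 1 N, s ≠ (n : ℂ) ∧ s ≠ -(n : ℂ)} := by
  have hU : IsOpen {s : ℂ | (N : ℝ) < s.re} := isOpen_lt continuous_const Complex.continuous_re
  have hsub : {s : ℂ | (N : ℝ) < s.re} ⊆
      {s : ℂ | ∀ n ∈ Finset.Icc 1 N, s ≠ (n : ℂ) ∧ s ≠ -(n : ℂ)} := by
    intro s hs n hn
    have hnN : (n : ℝ) ≤ N := by exact_mod_cast (Finset.mem_Icc.mp hn).2
    have hn0 : (0 : ℝ) ≤ n := n.cast_nonneg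
    simp only [Set.mem_ofPred_eq] at hs
    refine ⟨?_, ?_⟩ <;> rintro rfl <;>
      simp only [Complex.natCast_re, Complex.neg_re] at hs <;> linarith
  have heq : Set.EqOn (recMahlerIntegral N)
      (fun s => ∏ n ∈ Finset.Icc 1 N, 2 * (Real.pi : ℂ) * s / (s ^ 2 - (n : ℂ) ^ 2))
      {s : ℂ | (N : ℝ) < s.re} := fun s hs => recMahlerIntegral_eq_prod_Icc hs
  have han : AnalyticOnNhd ℂ
      (fun s => ∏ n ∈ Finset.Icc 1 N, 2 * (Real.pi : ℂ) * s / (s ^ 2 - (n : ℂ) ^ 2))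
      {s : ℂ | ∀ n ∈ Finset.Icc 1 N, s ≠ (n : ℂ) ∧ s ≠ -(n : ℂ)} := by
    intro s hs
    refine Finset.analyticAt_fun_prod _ fun n hn => ?_
    refine AnalyticAt.fun_div (by fun_prop) (by fun_prop) fun h0 => ?_
    rcases (sq_sub_natCast_sq_eq_zero_iff s n).mp h0 with h | h
    · exact (hs n hn).1 h
    · exact (hs n hn).2 h
  refine ⟨hU, ⟨(N : ℂ) + 1, by simp⟩, ?_, ?_, hsub, ?_, han, heq⟩
  · rw [setOf_ne_poles_eq]
    exact (finite_poles N).isClosed.isOpen_compl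
  · rw [setOf_ne_poles_eq]
    exact (finite_poles N).countable.isConnected_compl_of_one_lt_rank (by simp)
  · exact (han.mono hsub).congr hU heq.symm

theorem theorem2 (N : ℕ) (hN : 1 ≤ N) :
    (∀ s : ℂ, (N : ℝ) < s.re →
      Integrable (fun b : Fin N → ℂ => ((monicRecMahler b : ℝ) : ℂ) ^ (-2 * s)) volume) ∧
    ∃ R : RatFunc ℂ,
      R = ∏ n ∈ Finset.Icc 1 N,
        (RatFunc.C (2 * (Real.pi : ℂ)) * RatFunc.X) / (RatFunc.X ^ 2 - RatFunc.C ((n : ℂ) ^ 2)) ∧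
      IsAnalyticContinuation (recMahlerIntegral N) {s : ℂ | (N : ℝ) < s.re}
        (fun s => R.eval (RingHom.id ℂ) s)
        {s : ℂ | ∀ n ∈ Finset.Icc 1 N, s ≠ (n : ℂ) ∧ s ≠ -(n : ℂ)} ∧
      (Even N → Function.Even (fun s : ℂ => R.eval (RingHom.id ℂ) s)) ∧
      (Odd N → Function.Odd (fun s : ℂ => R.eval (RingHom.id ℂ) s)) := by
  refine ⟨fun s hs => integrable_monicRecMahler_cpow hs, _, rfl, ?_, fun h s => ?_, fun h s => ?_⟩
  · rw [funext (ratFunc_prod_eval N)]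
    exact isAnalyticContinuation_recMahlerIntegral N
  · simp only [ratFunc_prod_eval]
    rw [prod_Icc_neg, h.neg_one_pow, one_mul]
  · simp only [ratFunc_prod_eval]
    rw [prod_Icc_neg, h.neg_one_pow, neg_one_mul]
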